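/- Let $k\ge 2$ and $\ell\ge 1$ be integers, and let $s_1<\dots<s_k$ be $k$ servers on the real line with constant gap $s_{j+1}-s_j=d>0$ for $1\le j\le k-1$, each of capacity $\ell$. Requests $r_1,\dots,r_n\in\mathbb R$ with $n\le k\ell$ arrive one by one; an online algorithm must immediately and irrevocably match each request with a free server, i.e. one that has been matched with fewer than $\ell$ requests so far, and matching $r_i$ with $s_j$ costs $|r_i-s_j|$. The greedy algorithm $\mathrm{GRDY}$ matches each request with the nearest free server, choosing the one with the largest index in case of a tie. Let $\mathrm{GRDY}(\sigma)$ be its total cost on a request sequence $\sigma$, and let $\mathrm{OPT}(\sigma)$ be the minimum total cost of an (offline) assignment of all requests of $\sigma$ to the servers in which every server receives at most $\ell$ requests. The (strict) competitive ratio of $\mathrm{GRDY}$ is \[ \mathcal R(\mathrm{GRDY})=\inf\{c\ge 1:\ \mathrm{GRDY}(\sigma)\le c\cdot \mathrm{OPT}(\sigma)\ \text{for every request sequence } \sigma \text{ of length at most } k\ell\}. \] Then $\mathcal R(\mathrm{GRDY})=4k-5$. -/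

import Mathlib

namespace OFA

/-- A history: the pairs (position of a request, server it was matched with) of all the requests
processed so far, the most recent one first. The servers are numbered by `Fin k`. -/
abbrev History (X : Type*) (k : ℕ) := List (X × Fin k)

/-- Server `j` of capacity `ℓ` is free: fewer than `ℓ` requests have been matched with it. -/
def IsFree {X : Type*} {k : ℕ} (ℓ : ℕ) (h : History X k) (j : Fin k) : Prop :=
  h.countP (fun p => decide (p.2 = j)) < ℓ

/-- A deterministic online algorithm for `k` servers of capacity `ℓ`: from the history and the
position of the new request it irrevocably selects one of the free servers. -/
structure OnlineAlgorithm (X : Type*) (k ℓ : ℕ) where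
  select : (h : History X k) → X → (∃ j, IsFree ℓ h j) → Fin k
  select_free : ∀ h x hf, IsFree ℓ h (select h x hf)

open scoped Classical in
/-- Process one request. (If no server is free then the request is ignored; this never happens
for request sequences of length at most `k * ℓ`, and only those are considered below.) -/
noncomputable def OnlineAlgorithm.step {X : Type*} {k ℓ : ℕ} (A : OnlineAlgorithm X k ℓ)
    (h : History X k) (x : X) : History X k :=
  if hf : ∃ j, IsFree ℓ h j then (x, A.select h x hf) :: h else h

/-- The matching produced by the algorithm on the request sequence `σ`. -/
noncomputable def OnlineAlgorithm.run {X : Type*} {k ℓ : ℕ} (A : OnlineAlgorithm X k ℓ)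
    (σ : List X) : History X k :=
  σ.foldl A.step []

/-- The cost of the algorithm on `σ`, for servers at the positions `s`. -/
noncomputable def OnlineAlgorithm.cost {X : Type*} [MetricSpace X] {k ℓ : ℕ}
    (A : OnlineAlgorithm X k ℓ) (s : Fin k → X) (σ : List X) : ℝ :=
  ((A.run σ).map (fun p => dist p.1 (s p.2))).sum

/-- An offline assignment of `n` requests to the servers that respects the capacities. -/
def IsFeasible {k n : ℕ} (ℓ : ℕ) (f : Fin n → Fin k) : Prop :=
  ∀ j : Fin k, (Finset.univ.filter (fun i => f i = j)).card ≤ ℓ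

/-- The optimal offline cost: the minimum cost of a feasible assignment (the set is finite, and
it is nonempty as soon as `σ.length ≤ k * ℓ`, so that the infimum is a minimum). -/
noncomputable def opt {X : Type*} [MetricSpace X] {k : ℕ} (s : Fin k → X) (ℓ : ℕ)
    (σ : List X) : ℝ :=
  sInf {c : ℝ | ∃ f : Fin σ.length → Fin k, IsFeasible ℓ f ∧
    c = ∑ i : Fin σ.length, dist (σ.get i) (s (f i))}

/-- `A` is (strictly) `c`-competitive: its cost is at most `c` times the optimal offline cost on
every request sequence that does not exceed the total capacity. -/
def OnlineAlgorithm.IsCompetitive {X : Type*} [MetricSpace X] {k ℓ : ℕ}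
    (A : OnlineAlgorithm X k ℓ) (s : Fin k → X) (c : ℝ) : Prop :=
  ∀ σ : List X, σ.length ≤ k * ℓ → A.cost s σ ≤ c * opt s ℓ σ

/-- The competitive ratio: the infimum of all real `c ≥ 1` such that `A` is `c`-competitive, taken
in the extended reals (so it is `⊤` if there is no such `c`). -/
noncomputable def OnlineAlgorithm.competitiveRatio {X : Type*} [MetricSpace X] {k ℓ : ℕ}
    (A : OnlineAlgorithm X k ℓ) (s : Fin k → X) : EReal :=
  sInf ((fun c : ℝ => (c : EReal)) '' {c : ℝ | 1 ≤ c ∧ A.IsCompetitive s c})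

open scoped Classical in
/-- The free servers that are nearest to `x` among all free servers. -/
noncomputable def nearestFree {X : Type*} [MetricSpace X] {k : ℕ} (s : Fin k → X) (ℓ : ℕ)
    (h : History X k) (x : X) : Finset (Fin k) :=
  Finset.univ.filter (fun j => IsFree ℓ h j ∧ ∀ i, IsFree ℓ h i → dist x (s j) ≤ dist x (s i))

theorem nearestFree_nonempty {X : Type*} [MetricSpace X] {k : ℕ} (s : Fin k → X) (ℓ : ℕ)
    (h : History X k) (x : X) (hf : ∃ j, IsFree ℓ h j) : (nearestFree s ℓ h x).Nonempty := by
  classical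
  obtain ⟨j₀, hj₀⟩ := hf
  obtain ⟨j, hj, hmin⟩ := Finset.exists_min_image
    (Finset.univ.filter (fun j => IsFree ℓ h j)) (fun j => dist x (s j)) ⟨j₀, by simpa using hj₀⟩
  refine ⟨j, ?_⟩
  simp only [Finset.mem_filter, Finset.mem_univ, true_and] at hj hmin
  simp only [nearestFree, Finset.mem_filter, Finset.mem_univ, true_and]
  exact ⟨hj, hmin⟩

/-- The greedy algorithm for servers at the positions `s`: each request is matched with the nearest
free server, and with the one of largest index if several free servers are nearest. -/
noncomputable def greedy {X : Type*} [MetricSpace X] {k : ℕ} (s : Fin k → X) (ℓ : ℕ) :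
    OnlineAlgorithm X k ℓ where
  select h x hf := (nearestFree s ℓ h x).max' (nearestFree_nonempty s ℓ h x hf)
  select_free h x hf := by
    classical
    have := (nearestFree s ℓ h x).max'_mem (nearestFree_nonempty s ℓ h x hf)
    simp only [nearestFree, Finset.mem_filter, Finset.mem_univ, true_and] at this
    exact this.1

/-- The servers lie on the real line in increasing order, with a constant gap `d > 0` between
consecutive ones. -/
def IsEquidistant {k : ℕ} (s : Fin k → ℝ) : Prop :=
  ∃ d : ℝ, 0 < d ∧ ∀ (j : ℕ) (hj : j + 1 < k),
    s ⟨j + 1, hj⟩ - s ⟨j, Nat.lt_of_succ_lt hj⟩ = d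

end OFA

/-! Upper bound: fix any feasible assignment and switch from it to the nearest rule one request at a
time. If the assignment sends `r` to `j` and the rule sends it to `x ≠ j`, then `|r - s x| ≤ |r - s
j|`, and the two continuations start from capacities that differ by one unit placed at `j` instead
of `x`. Such a displaced unit raises the later cost by at most `(2 * k - 3) * d`
(`runCost_add_single_sub_le`). Since `d ≤ |s x - s j| ≤ 2 * |r - s j|`, replacing the choice costs
at most `(1 + 2 * (2 * k - 3)) * |r - s j| = (4 * k - 5) * |r - s j|`; summing over the requests
gives `runCost_le`.

The displaced unit is controlled by `runCost_sub_le`. Two runs whose capacities differ by one unit,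
at `a` or at `b`, keep differing by at most one unit: each request is served alike, moves one end of
the pair to another server, or merges the runs. The plain bound `2 * (hi - lo)` is not inductive; it
is strengthened by subtracting the length of an interval next to `a` without free servers. When `a`
is replaced by `y`, the nearest server to `r`, no free server lies strictly between `y` and its
mirror image in `r`. This gap of length `2 * |r - s y|` pays for the detour.

Lower bound: after all capacities are reduced to one, a request midway between the first two servers
goes right, and requests at the positions of all servers but the first push one another to the right
until the last one must travel back to the first server. -/

namespace OFA

/-! ### Nearest rules and the effect of displacing one unit of capacity -/

/-- A rule selecting a nearest server with positive remaining capacity, in such a way that ties are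
broken in the same manner for all capacity vectors. -/
structure IsNearestRule {k : ℕ} (s : Fin k → ℝ) (sel : (Fin k → ℕ) → ℝ → Fin k) : Prop where
  pos : ∀ (c : Fin k → ℕ) x j, 0 < c j → 0 < c (sel c x)
  le : ∀ (c : Fin k → ℕ) x j, 0 < c j → |x - s (sel c x)| ≤ |x - s j|
  consistent : ∀ (c c' : Fin k → ℕ) x, 0 < c (sel c' x) → 0 < c' (sel c x) → sel c x = sel c' x

/-- The cost of serving `σ` with the rule `sel`, starting from the remaining capacities `c`. -/
def runCost {k : ℕ} (s : Fin k → ℝ) (sel : (Fin k → ℕ) → ℝ → Fin k) :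
    (Fin k → ℕ) → List ℝ → ℝ
  | _, [] => 0
  | c, x :: σ => |x - s (sel c x)| + runCost s sel (c - Pi.single (sel c x) 1) σ

theorem abs_sub_le_abs_sub_iff_of_lt {a b r : ℝ} (h : a < b) :
    |r - a| ≤ |r - b| ↔ 2 * r ≤ a + b := by
  rw [← sq_le_sq]
  constructor
  · intro h1
    nlinarith
  · intro h1
    nlinarith

theorem abs_sub_le_abs_sub_iff_of_gt {a b r : ℝ} (h : b < a) :
    |r - a| ≤ |r - b| ↔ a + b ≤ 2 * r := by
  rw [← sq_le_sq]
  constructor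
  · intro h1
    nlinarith
  · intro h1
    nlinarith

theorem add_single_sub_single {k : ℕ} {F : Fin k → ℕ} {y : Fin k} (hy : 0 < F y) (a : Fin k) :
    F + Pi.single a 1 - Pi.single y 1 = (F - Pi.single y 1) + Pi.single a 1 := by
  refine (tsub_add_eq_add_tsub ?_).symm
  intro j
  rcases eq_or_ne j y with rfl | h
  · simpa using Nat.succ_le_of_lt hy
  · simp [h]

theorem sub_single_add_single {k : ℕ} {F : Fin k → ℕ} {y : Fin k} (hy : 0 < F y) :
    F - Pi.single y 1 + Pi.single y 1 = F := by
  refine tsub_add_cancel_of_le ?_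
  intro j
  rcases eq_or_ne j y with rfl | h
  · simpa using Nat.succ_le_of_lt hy
  · simp [h]

theorem pos_of_pos_sub {k : ℕ} {F G : Fin k → ℕ} {j : Fin k} (h : 0 < (F - G) j) : 0 < F j :=
  lt_of_lt_of_le h (Nat.sub_le _ _)

/-- Moving one unit of capacity from `a` to a server `b` on its right: bounds for the increase of
the cost in terms of the interval around `a` without free servers. -/
theorem runCost_sub_le {k : ℕ} {s : Fin k → ℝ} {sel : (Fin k → ℕ) → ℝ → Fin k}
    (hsel : IsNearestRule s sel) (hinj : Function.Injective s) {lo hi : ℝ}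
    (hlo : ∀ j, lo ≤ s j) (hhi : ∀ j, s j ≤ hi) (σ : List ℝ) :
    ∀ (F : Fin k → ℕ) (a b : Fin k), s a < s b →
      (∀ p, lo ≤ p → p ≤ s a → (∀ j, 0 < F j → s j < s a → s j ≤ p) →
        runCost s sel (F + Pi.single b 1) σ - runCost s sel (F + Pi.single a 1) σ
          ≤ 2 * (hi - lo) - (s a - p)) ∧
      (∀ q, s a ≤ q → q ≤ s b → (∀ j, 0 < F j → s a < s j → q ≤ s j) →
        runCost s sel (F + Pi.single b 1) σ - runCost s sel (F + Pi.single a 1) σ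
          ≤ 2 * (hi - lo) - (q - s a)) ∧
      ((∀ j, 0 < F j → s a ≤ s j) →
        runCost s sel (F + Pi.single b 1) σ - runCost s sel (F + Pi.single a 1) σ
          ≤ hi - s a) := by
  induction σ with
  | nil =>
    intro F a b hab
    have h1 := hlo a
    have h2 := hhi a
    have h3 := hhi b
    simp only [runCost]
    refine ⟨fun p _ _ _ => ?_, fun q _ _ _ => ?_, fun _ => ?_⟩ <;> linarith
  | cons r σ ih =>
    intro F a b hab
    have hla := hlo a
    have hhb := hhi b
    simp only [runCost]
    set x := sel (F + Pi.single a 1) r with hx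
    set y := sel (F + Pi.single b 1) r with hy
    have hxpos : 0 < (F + Pi.single a 1 : Fin k → ℕ) x := hsel.pos _ r a (by simp)
    have hypos : 0 < (F + Pi.single b 1 : Fin k → ℕ) y := hsel.pos _ r b (by simp)
    have hxle : ∀ j, 0 < F j → |r - s x| ≤ |r - s j| := fun j hj =>
      hsel.le _ r j (by simp; omega)
    have hyle : ∀ j, 0 < F j → |r - s y| ≤ |r - s j| := fun j hj =>
      hsel.le _ r j (by simp; omega)
    have hxa : |r - s x| ≤ |r - s a| := hsel.le _ r a (by simp)
    have hyb : |r - s y| ≤ |r - s b| := hsel.le _ r b (by simp)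
    have hcons := hsel.consistent (F + Pi.single a 1) (F + Pi.single b 1) r
    rw [← hx, ← hy] at hcons
    have hx' : 0 < F x ∨ x = a := by
      by_contra! h
      simp [h.2] at hxpos
      omega
    have hy' : 0 < F y ∨ y = b := by
      by_contra! h
      simp [h.2] at hypos
      omega
    clear_value x y
    by_cases hFx : 0 < F x
    · by_cases hFy : 0 < F y
      · -- both runs use the same server
        obtain rfl : x = y := hcons (by simp; omega) (by simp; omega)
        rw [add_single_sub_single hFx, add_single_sub_single hFx]
        obtain ⟨h1, h2, h3⟩ := ih (F - Pi.single x 1) a b hab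
        refine ⟨fun p hp hpa hF => ?_, fun q hq hqb hF => ?_, fun hF => ?_⟩
        · have := h1 p hp hpa fun j hj => hF j (pos_of_pos_sub hj)
          linarith
        · have := h2 q hq hqb fun j hj => hF j (pos_of_pos_sub hj)
          linarith
        · have := h3 fun j hj => hF j (pos_of_pos_sub hj)
          linarith
      · -- the extra server of the second run moves from `b` to `x`
        obtain rfl : y = b := hy'.resolve_left hFy
        rw [add_single_sub_single hFx, add_tsub_cancel_right]
        have hstep := hyle x hFx
        -- If `x` were left of `a`, then `r` would be at most the midpoint of `x` and `a`, yet at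
        -- least the midpoint of `x` and `b`, which is larger.
        have hax : s a ≤ s x := by
          by_contra! h
          have h4 := (abs_sub_le_abs_sub_iff_of_lt h).1 hxa
          have h5 := (abs_sub_le_abs_sub_iff_of_gt (h.trans hab)).1 hstep
          linarith
        rcases hax.eq_or_lt with hax | hax
        · obtain rfl : a = x := hinj hax
          have h1 := hhi a
          rw [sub_single_add_single hFx]
          refine ⟨fun p hp hpa hF => ?_, fun q hq hqb hF => ?_, fun hF => ?_⟩ <;> linarith
        · have ihx := ih (F - Pi.single x 1) a x hax
          rw [sub_single_add_single hFx] at ihx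
          obtain ⟨h1, h2, h3⟩ := ihx
          refine ⟨fun p hp hpa hF => ?_, fun q hq hqb hF => ?_, fun hF => ?_⟩
          · have := h1 p hp hpa fun j hj => hF j (pos_of_pos_sub hj)
            linarith
          · have := h2 q hq (hF x hFx hax) fun j hj => hF j (pos_of_pos_sub hj)
            linarith
          · have := h3 fun j hj => hF j (pos_of_pos_sub hj)
            linarith
    · obtain rfl : x = a := hx'.resolve_left hFx
      by_cases hFy : 0 < F y
      · -- the extra server of the first run moves from `x` to `y`
        have hne : s y ≠ s x := fun h => hFx (hinj h ▸ hFy)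
        have hly := hlo y
        have hhy := hhi y
        have hxy := hxle y hFy
        rw [add_single_sub_single hFy, add_tsub_cancel_right]
        -- The chosen `y` is no nearer than `x` and no farther than `b`, so `r` is left of the
        -- midpoint of `x` and `b`; hence `y` cannot lie beyond `b`.
        have hmid := (abs_sub_le_abs_sub_iff_of_lt hab).1 (hxy.trans hyb)
        have hyle' : s y ≤ s b := by
          by_contra! h
          have h5 := (abs_sub_le_abs_sub_iff_of_gt h).1 hyb
          linarith
        rcases hne.lt_or_gt with hlt | hgt
        · have hr := (abs_sub_le_abs_sub_iff_of_gt hlt).1 hxy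
          have hry : |r - s y| = r - s y := abs_of_nonneg (by linarith)
          have hrx := neg_abs_le (r - s x)
          have hrx' := le_abs_self (r - s x)
          have hrb := (abs_sub_le_abs_sub_iff_of_lt (hlt.trans hab)).1 hyb
          -- `2 * r - s y` is the mirror image of `y` in `r`; a free server strictly between the two
          -- would be nearer than `y`. This gap is what the induction hypothesis for the pair `y`,
          -- `b` subtracts.
          have hempty : ∀ j, 0 < F j → s y < s j → 2 * r - s y ≤ s j := fun j hj hyj => by
            have := (abs_sub_le_abs_sub_iff_of_lt hyj).1 (hyle j hj)
            linarith
          have ihy := ih (F - Pi.single y 1) y b (hlt.trans hab)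
          rw [sub_single_add_single hFy] at ihy
          obtain ⟨-, h2, -⟩ := ihy
          refine ⟨fun p hp hpa hF => ?_, fun q hq hqb hF => ?_, fun hF => ?_⟩
          · have h4 := hF y hFy hlt
            have := h2 (2 * r - s y) (by linarith) (by linarith)
              fun j hj => hempty j (pos_of_pos_sub hj)
            linarith
          · have := h2 q (by linarith) hqb fun j hj hyj => by
              have hj := pos_of_pos_sub hj
              have h5 := hempty j hj hyj
              have h6 : s x ≠ s j := fun h => hFx (hinj h ▸ hj)
              exact hF j hj (lt_of_le_of_ne (by linarith) h6)
            linarith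
          · linarith [hF y hFy]
        · have hr := (abs_sub_le_abs_sub_iff_of_lt hgt).1 hxy
          have hry : |r - s y| = s y - r := by
            rw [abs_of_nonpos (by linarith)]
            ring
          have hrx := neg_abs_le (r - s x)
          have hrx' := le_abs_self (r - s x)
          rcases hyle'.eq_or_lt with hyb' | hyb'
          · obtain rfl := hinj hyb'
            rw [sub_single_add_single hFy]
            refine ⟨fun p hp hpa hF => ?_, fun q hq hqb hF => ?_, fun hF => ?_⟩ <;> linarith
          have hempty : ∀ j, 0 < F j → s j < s y → s j ≤ 2 * r - s y := fun j hj hyj => by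
            have := (abs_sub_le_abs_sub_iff_of_gt hyj).1 (hyle j hj)
            linarith
          have ihy := ih (F - Pi.single y 1) y b hyb'
          rw [sub_single_add_single hFy] at ihy
          obtain ⟨h1, h2, h3⟩ := ihy
          refine ⟨fun p hp hpa hF => ?_, fun q hq hqb hF => ?_, fun hF => ?_⟩
          · have := h1 p hp (by linarith) fun j hj hyj => by
              have hj := pos_of_pos_sub hj
              have h5 := hempty j hj hyj
              have h6 : s j ≠ s x := fun h => hFx (hinj h ▸ hj)
              exact hF j hj (lt_of_le_of_ne (by linarith) h6)
            linarith
          · have h4 := hF y hFy hgt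
            -- If the mirror image of `y` falls left of `lo`, no free server lies left of `y`, and
            -- the one-sided third bound applies instead.
            by_cases hcase : lo ≤ 2 * r - s y
            · have := h1 (2 * r - s y) hcase (by linarith)
                fun j hj => hempty j (pos_of_pos_sub hj)
              linarith
            · have := h3 fun j hj => by
                by_contra! hyj
                have := hempty j (pos_of_pos_sub hj) hyj
                linarith [hlo j]
              linarith
          · have := h3 fun j hj => by
              by_contra! hyj
              have h5 := hempty j (pos_of_pos_sub hj) hyj
              have h6 := hF j (pos_of_pos_sub hj)
              have h7 : s j ≠ s x := fun h => hFx (hinj h ▸ pos_of_pos_sub hj)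
              exact h7 (by linarith)
            linarith
      · -- the two runs coincide from now on
        obtain rfl : y = b := hy'.resolve_left hFy
        rw [add_tsub_cancel_right, add_tsub_cancel_right]
        have h1 : |r - s y| ≤ |r - s x| + (s y - s x) := by
          have := abs_sub_le r (s x) (s y)
          rwa [abs_sub_comm (s x), abs_of_pos (sub_pos.2 hab)] at this
        refine ⟨fun p hp hpa hF => ?_, fun q hq hqb hF => ?_, fun hF => ?_⟩ <;> linarith

/-- Reflecting the line turns ties to the right into ties to the left. Because the notion only asks
for consistent ties, it is preserved, and the case of `b` left of `a` follows from the other one. -/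
theorem IsNearestRule.neg {k : ℕ} {s : Fin k → ℝ} {sel : (Fin k → ℕ) → ℝ → Fin k}
    (hsel : IsNearestRule s sel) :
    IsNearestRule (fun j => -s j) (fun c x => sel c (-x)) where
  pos c x j hj := hsel.pos c (-x) j hj
  le c x j hj := by
    have := hsel.le c (-x) j hj
    rw [← abs_neg, ← abs_neg (x - -s j)]
    convert this using 2 <;> ring
  consistent c c' x := hsel.consistent c c' (-x)

theorem runCost_neg {k : ℕ} (s : Fin k → ℝ) (sel : (Fin k → ℕ) → ℝ → Fin k) (σ : List ℝ) :
    ∀ c, runCost (fun j => -s j) (fun c x => sel c (-x)) c (σ.map (fun x => -x))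
      = runCost s sel c σ := by
  induction σ with
  | nil => intro c; rfl
  | cons x σ ih =>
    intro c
    simp only [List.map_cons, runCost, neg_neg, ih]
    rw [← abs_neg]
    congr 2
    ring

/-! ### Upper bound for equidistant servers -/

section Equidistant

variable {k : ℕ} {s : Fin k → ℝ} {sel : (Fin k → ℕ) → ℝ → Fin k}

/-- The servers span `(k - 1) * d`, and the interval of length `d` from `a` towards `b` contains no
server in its interior: this gives `2 * (k - 1) * d - d`. -/
theorem runCost_add_single_sub_le {x₀ d : ℝ} (hd : 0 < d)
    (hs : ∀ j : Fin k, s j = x₀ + j * d) (hsel : IsNearestRule s sel) (σ : List ℝ)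
    (F : Fin k → ℕ) {a b : Fin k} (hab : a ≠ b) :
    runCost s sel (F + Pi.single b 1) σ - runCost s sel (F + Pi.single a 1) σ
      ≤ (2 * k - 3) * d := by
  have hlt : ∀ i j : Fin k, s i < s j ↔ i < j := fun i j => by
    rw [hs, hs, add_lt_add_iff_left, mul_lt_mul_iff_left₀ hd, Nat.cast_lt, Fin.lt_def]
  have hgap : ∀ i j : Fin k, i < j → s i + d ≤ s j := fun i j hij => by
    have : (i : ℝ) + 1 ≤ j := by exact_mod_cast hij
    rw [hs, hs]
    nlinarith
  have hinj : Function.Injective s := fun i j hij => by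
    rcases lt_trichotomy i j with h | h | h
    · exact absurd ((hlt i j).2 h) (by rw [hij]; exact lt_irrefl _)
    · exact h
    · exact absurd ((hlt j i).2 h) (by rw [hij]; exact lt_irrefl _)
  have hlo : ∀ j, x₀ ≤ s j := fun j => by
    rw [hs]
    have : (0 : ℝ) ≤ j * d := by positivity
    linarith
  have hhi : ∀ j, s j ≤ x₀ + (k - 1) * d := fun j => by
    have : (j : ℝ) + 1 ≤ k := by exact_mod_cast j.2
    rw [hs]
    nlinarith
  rcases hab.lt_or_gt with h | h
  · have := (runCost_sub_le hsel hinj hlo hhi σ F a b ((hlt a b).2 h)).2.1 (s a + d)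
      (by linarith) (hgap a b h) fun j _ haj => hgap a j ((hlt a j).1 haj)
    linarith
  · have := (runCost_sub_le hsel.neg (neg_injective.comp hinj) (fun j => neg_le_neg (hhi j))
      (fun j => neg_le_neg (hlo j)) (σ.map (fun x => -x)) F a b
      (neg_lt_neg ((hlt b a).2 h))).2.1 (-s a + d)
      (by linarith) (by linarith [hgap b a h])
      fun j _ haj => by linarith [hgap j a ((hlt j a).1 (neg_lt_neg_iff.1 haj))]
    rw [runCost_neg, runCost_neg] at this
    linarith

/-- Serving with a nearest rule costs at most `4 * k - 5` times any assignment that respects the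
capacities. -/
theorem runCost_le {x₀ d : ℝ} (hd : 0 < d) (hk : 2 ≤ k)
    (hs : ∀ j : Fin k, s j = x₀ + j * d) (hsel : IsNearestRule s sel) (τ : List (ℝ × Fin k)) :
    ∀ c : Fin k → ℕ, (∀ j, τ.countP (fun p => decide (p.2 = j)) ≤ c j) →
      runCost s sel c (τ.map Prod.fst)
        ≤ (4 * k - 5) * (τ.map (fun p => |p.1 - s p.2|)).sum := by
  have hk' : (2 : ℝ) ≤ k := by exact_mod_cast hk
  induction τ with
  | nil => intro c _; simp [runCost]
  | cons p τ ih =>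
    obtain ⟨r, j⟩ := p
    intro c hc
    simp only [List.map_cons, List.sum_cons, runCost]
    have hcj : 0 < c j := by
      have := hc j
      simp only [List.countP_cons, decide_true, if_true] at this
      omega
    have hx := hsel.pos c r j hcj
    have hle := hsel.le c r j hcj
    set x := sel c r
    have hih := ih (c - Pi.single j 1) fun i => by
      have := hc i
      rcases eq_or_ne i j with rfl | h
      · simp only [List.countP_cons, decide_true, if_true] at this
        simp
        omega
      · simpa [List.countP_cons, h, h.symm] using this
    by_cases hxj : x = j
    · rw [hxj]
      nlinarith [abs_nonneg (r - s j)]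
    -- The common part of the two states is `c` without one unit at `x` and one at `j`. Restoring
    -- the unit at `j` gives the state after the rule's choice; restoring the one at `x` gives the
    -- state to which the induction hypothesis applies.
    · have hF := runCost_add_single_sub_le hd hs hsel (τ.map Prod.fst)
        (c - Pi.single x 1 - Pi.single j 1) hxj
      have hj' : 0 < (c - Pi.single x 1 : Fin k → ℕ) j := by
        simpa [Ne.symm hxj] using hcj
      have hx' : 0 < (c - Pi.single j 1 : Fin k → ℕ) x := by simpa [hxj] using hx
      rw [sub_single_add_single hj', tsub_right_comm, sub_single_add_single hx'] at hF
      have hδ : d ≤ 2 * |r - s j| := by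
        have h1 : d ≤ |s x - s j| := by
          have h2 : s x - s j = (((x : ℤ) - (j : ℤ) : ℤ) : ℝ) * d := by
            rw [hs, hs]
            push_cast
            ring
          have h3 : (1 : ℤ) ≤ |(x : ℤ) - (j : ℤ)| := by
            apply Int.one_le_abs
            intro h
            apply hxj
            ext
            omega
          have h4 : (1 : ℝ) ≤ |(((x : ℤ) - (j : ℤ) : ℤ) : ℝ)| := by exact_mod_cast h3
          rw [h2, abs_mul, abs_of_pos hd]
          nlinarith
        have h2 := abs_sub_le (s x) r (s j)
        rw [abs_sub_comm (s x) r] at h2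
        linarith
      nlinarith

end Equidistant

/-! ### The greedy algorithm as a nearest rule on remaining capacities -/

section Greedy

variable {k : ℕ}

open scoped Classical in
/-- The selection of the greedy algorithm in terms of the remaining capacities. -/
noncomputable def greedySelect [NeZero k] (s : Fin k → ℝ) (c : Fin k → ℕ) (x : ℝ) : Fin k :=
  if h : (Finset.univ.filter
      (fun j => 0 < c j ∧ ∀ i, 0 < c i → dist x (s j) ≤ dist x (s i))).Nonempty
  then Finset.max' _ h else 0

theorem greedySelect_spec [NeZero k] (s : Fin k → ℝ) {c : Fin k → ℕ} (x : ℝ) {i : Fin k} (hi : 0 < c i) :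
    0 < c (greedySelect s c x) ∧
      (∀ j, 0 < c j → |x - s (greedySelect s c x)| ≤ |x - s j|) ∧
      ∀ j, 0 < c j → |x - s j| ≤ |x - s (greedySelect s c x)| → j ≤ greedySelect s c x := by
  classical
  have hne : (Finset.univ.filter
      (fun j => 0 < c j ∧ ∀ i, 0 < c i → dist x (s j) ≤ dist x (s i))).Nonempty := by
    obtain ⟨j, hj, hmin⟩ := Finset.exists_min_image
      (Finset.univ.filter (fun j => 0 < c j)) (fun j => dist x (s j)) ⟨i, by simpa using hi⟩
    exact ⟨j, by simpa using ⟨by simpa using hj, fun i hi => hmin i (by simpa using hi)⟩⟩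
  have hdef : greedySelect s c x = Finset.max' _ hne := by
    rw [greedySelect, dif_pos hne]
  have hmem := Finset.max'_mem _ hne
  rw [← hdef] at hmem
  simp only [Finset.mem_filter, Finset.mem_univ, true_and, Real.dist_eq] at hmem
  refine ⟨hmem.1, hmem.2, fun j hj hle => ?_⟩
  rw [hdef] at hle ⊢
  refine Finset.le_max' _ _ ?_
  rw [← hdef] at hle
  simp only [Finset.mem_filter, Finset.mem_univ, true_and, Real.dist_eq]
  exact ⟨hj, fun i hi => hle.trans (hmem.2 i hi)⟩

/-- Consistency: if each choice is available in the other state, both are equally near, and each has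
an index at least that of the other. -/
theorem isNearestRule_greedySelect [NeZero k] (s : Fin k → ℝ) : IsNearestRule s (greedySelect s) where
  pos _ x _ hj := (greedySelect_spec s x hj).1
  le _ x j hj := (greedySelect_spec s x hj).2.1 j hj
  consistent c c' x h h' := by
    obtain ⟨h1, h2, h3⟩ := greedySelect_spec s x h
    obtain ⟨h1', h2', h3'⟩ := greedySelect_spec s x h'
    exact le_antisymm (h3' _ h' (h2 _ h)) (h3 _ h (h2' _ h'))

theorem greedySelect_eq [NeZero k] (s : Fin k → ℝ) {c : Fin k → ℕ} {x : ℝ} {i : Fin k} (hi : 0 < c i)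
    (h : ∀ j, 0 < c j → j ≠ i → |x - s i| < |x - s j| ∨ |x - s i| = |x - s j| ∧ j < i) :
    greedySelect s c x = i := by
  obtain ⟨h1, h2, h3⟩ := greedySelect_spec s x hi
  by_contra hne
  rcases h _ h1 hne with h4 | ⟨h4, h5⟩
  · exact absurd (h2 i hi) (not_le.2 h4)
  · exact absurd (h3 i hi h4.le) (not_le.2 h5)

/-- The remaining capacities after the history `h`. -/
def remaining (ℓ : ℕ) (h : History ℝ k) (j : Fin k) : ℕ :=
  ℓ - h.countP (fun p => decide (p.2 = j))

theorem isFree_iff_remaining_pos (ℓ : ℕ) (h : History ℝ k) (j : Fin k) :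
    IsFree ℓ h j ↔ 0 < remaining ℓ h j := by
  simp only [IsFree, remaining]
  omega

theorem remaining_cons (ℓ : ℕ) (h : History ℝ k) (x : ℝ) (i : Fin k) :
    remaining ℓ ((x, i) :: h) = remaining ℓ h - Pi.single i 1 := by
  ext j
  rcases eq_or_ne j i with rfl | hne
  · simp [remaining]
    omega
  · simp [remaining, hne, hne.symm]

theorem greedy_select_eq [NeZero k] (s : Fin k → ℝ) (ℓ : ℕ) (h : History ℝ k) (x : ℝ)
    (hf : ∃ j, IsFree ℓ h j) :
    (greedy s ℓ).select h x hf = greedySelect s (remaining ℓ h) x := by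
  classical
  have hmem := Finset.max'_mem _ (nearestFree_nonempty s ℓ h x hf)
  set i := (nearestFree s ℓ h x).max' (nearestFree_nonempty s ℓ h x hf) with hi
  change i = _
  simp only [nearestFree, Finset.mem_filter, Finset.mem_univ, true_and] at hmem
  simp only [isFree_iff_remaining_pos, Real.dist_eq] at hmem
  refine (greedySelect_eq s hmem.1 fun j hj hne => ?_).symm
  rcases (hmem.2 j hj).lt_or_eq with h1 | h1
  · exact Or.inl h1
  · refine Or.inr ⟨h1, lt_of_le_of_ne ?_ hne⟩
    refine Finset.le_max' _ _ ?_
    simp only [nearestFree, Finset.mem_filter, Finset.mem_univ, true_and]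
    simp only [isFree_iff_remaining_pos, Real.dist_eq]
    exact ⟨hj, fun m hm => h1 ▸ hmem.2 m hm⟩

theorem exists_pos_of_sum_pos {c : Fin k → ℕ} (h : 0 < ∑ j, c j) : ∃ j, 0 < c j := by
  by_contra! h0
  have : ∑ j, c j = 0 := Finset.sum_eq_zero fun j _ => Nat.le_zero.1 (h0 j)
  omega

/-- Passes from histories to capacity vectors, on which the exchange argument works. The length
hypothesis rules out the branch of `step` that ignores a request. -/
theorem sum_foldl_greedy_step [NeZero k] (s : Fin k → ℝ) (ℓ : ℕ) (σ : List ℝ) :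
    ∀ h : History ℝ k, σ.length ≤ ∑ j, remaining ℓ h j →
      ((σ.foldl (greedy s ℓ).step h).map (fun p => dist p.1 (s p.2))).sum
        = (h.map (fun p => dist p.1 (s p.2))).sum
          + runCost s (greedySelect s) (remaining ℓ h) σ := by
  induction σ with
  | nil => intro h _; simp [runCost]
  | cons x σ ih =>
    intro h hσ
    rw [List.length_cons] at hσ
    obtain ⟨j, hj⟩ := exists_pos_of_sum_pos (lt_of_lt_of_le (Nat.succ_pos _) hσ)
    have hf : ∃ j, IsFree ℓ h j := ⟨j, (isFree_iff_remaining_pos ℓ h j).2 hj⟩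
    have hstep : (greedy s ℓ).step h x = (x, greedySelect s (remaining ℓ h) x) :: h := by
      rw [OnlineAlgorithm.step, dif_pos hf, greedy_select_eq]
    have hpos := (greedySelect_spec s x hj).1
    rw [List.foldl_cons, hstep, ih, remaining_cons]
    · simp only [List.map_cons, List.sum_cons, runCost, Real.dist_eq]
      ring
    · rw [remaining_cons]
      have hsum := congrArg (fun f : Fin k → ℕ => ∑ j, f j) (sub_single_add_single hpos)
      simp only [Pi.add_apply, Finset.sum_add_distrib, Finset.sum_pi_single', Finset.mem_univ,
        if_true] at hsum
      omega

theorem greedy_cost_eq [NeZero k] (s : Fin k → ℝ) {ℓ : ℕ} {σ : List ℝ} (hσ : σ.length ≤ k * ℓ) :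
    (greedy s ℓ).cost s σ = runCost s (greedySelect s) (fun _ => ℓ) σ := by
  have h := sum_foldl_greedy_step s ℓ σ [] (by simpa [remaining] using hσ)
  have h0 : remaining ℓ ([] : History ℝ k) = fun _ => ℓ := by
    ext j
    simp [remaining]
  rw [h0] at h
  simpa [OnlineAlgorithm.cost, OnlineAlgorithm.run] using h

end Greedy

/-! ### Offline assignments and the competitiveness of greedy -/

theorem card_filter_eq_countP {n k : ℕ} (f : Fin n → Fin k) (σ : Fin n → ℝ) (j : Fin k) :
    (List.ofFn fun i => (σ i, f i)).countP (fun p => decide (p.2 = j))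
      = (Finset.univ.filter (fun i => f i = j)).card := by
  rw [List.ofFn_eq_map, List.countP_map, Finset.card_def, Finset.filter_val,
    ← Multiset.countP_eq_card_filter]
  rfl

/-- Blocks of `ℓ` consecutive requests go to the same server. Nonemptiness is needed to bound the
infimum `opt` from below. -/
theorem exists_isFeasible {n k ℓ : ℕ} (h : n ≤ k * ℓ) : ∃ f : Fin n → Fin k, IsFeasible ℓ f := by
  have hlt : ∀ i : Fin n, (i : ℕ) / ℓ < k := fun i =>
    Nat.div_lt_of_lt_mul (by rw [mul_comm]; exact i.2.trans_le h)
  refine ⟨fun i => ⟨i / ℓ, hlt i⟩, fun j => ?_⟩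
  rcases Nat.eq_zero_or_pos ℓ with rfl | hℓ
  · have : n = 0 := by simpa using h
    subst this
    simp
  calc _ ≤ (Finset.Ico ((j : ℕ) * ℓ) (j * ℓ + ℓ)).card := by
        refine Finset.card_le_card_of_injOn (fun i => (i : ℕ)) (fun i hi => ?_)
          (fun i _ i' _ h => Fin.ext h)
        simp only [Finset.coe_filter, Finset.mem_univ, true_and, Set.mem_ofPred_eq, Fin.ext_iff]
          at hi
        rw [Nat.div_eq_iff hℓ] at hi
        simp only [Finset.coe_Ico, Set.mem_Ico]
        omega
    _ = ℓ := by simp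

theorem IsEquidistant.exists_eq {k : ℕ} {s : Fin k → ℝ} (hk : 0 < k) (hs : IsEquidistant s) :
    ∃ x₀ d : ℝ, 0 < d ∧ ∀ j : Fin k, s j = x₀ + j * d := by
  obtain ⟨d, hd, h⟩ := hs
  refine ⟨s ⟨0, hk⟩, d, hd, fun ⟨j, hj⟩ => ?_⟩
  induction j with
  | zero => simp
  | succ j ih =>
    have h1 := h j hj
    have h2 := ih (Nat.lt_of_succ_lt hj)
    push_cast at h2 ⊢
    linarith

theorem sum_dist_eq_sum_ofFn {n k : ℕ} (s : Fin k → ℝ) (x : Fin n → ℝ) (f : Fin n → Fin k) :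
    ∑ i, dist (x i) (s (f i))
      = ((List.ofFn fun i => (x i, f i)).map (fun p => |p.1 - s p.2|)).sum := by
  rw [List.map_ofFn, List.sum_ofFn]
  rfl

theorem opt_le {k ℓ : ℕ} (s : Fin k → ℝ) (τ : List (ℝ × Fin k))
    (hτ : ∀ j, τ.countP (fun p => decide (p.2 = j)) ≤ ℓ) :
    opt s ℓ (τ.map Prod.fst) ≤ (τ.map (fun p => |p.1 - s p.2|)).sum := by
  let f : Fin (τ.map Prod.fst).length → Fin k := fun i => (τ.get (i.cast (by simp))).2
  have hf : (List.ofFn fun i => ((τ.map Prod.fst).get i, f i)) = τ := by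
    refine List.ext_getElem (by simp) fun i h1 h2 => ?_
    simp [f]
  refine csInf_le ⟨0, ?_⟩ ⟨f, fun j => ?_, ?_⟩
  · rintro _ ⟨g, -, rfl⟩
    exact Finset.sum_nonneg fun _ _ => dist_nonneg
  · rw [← card_filter_eq_countP f (τ.map Prod.fst).get, hf]
    exact hτ j
  · rw [sum_dist_eq_sum_ofFn, hf]

theorem greedy_isCompetitive {k ℓ : ℕ} (hk : 2 ≤ k) {s : Fin k → ℝ} (hs : IsEquidistant s) :
    (greedy s ℓ).IsCompetitive s (4 * k - 5) := by
  obtain ⟨x₀, d, hd, hs⟩ := hs.exists_eq (by omega)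
  have : NeZero k := ⟨by omega⟩
  have hk' : (2 : ℝ) ≤ k := by exact_mod_cast hk
  have hc : (0 : ℝ) < 4 * k - 5 := by linarith
  intro σ hσ
  rw [greedy_cost_eq s hσ, ← div_le_iff₀' hc]
  obtain ⟨f₀, hf₀⟩ := exists_isFeasible hσ
  refine le_csInf ⟨_, f₀, hf₀, rfl⟩ ?_
  rintro _ ⟨f, hf, rfl⟩
  rw [div_le_iff₀' hc, sum_dist_eq_sum_ofFn]
  have h := runCost_le hd hk hs (isNearestRule_greedySelect s)
    (List.ofFn fun i => (σ.get i, f i)) (fun _ => ℓ)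
    fun j => (card_filter_eq_countP f σ.get j).trans_le (hf j)
  have hfst : (List.ofFn fun i => (σ.get i, f i)).map Prod.fst = σ := by
    rw [List.map_ofFn]
    exact List.ofFn_get σ
  rwa [hfst] at h

/-- Requests at the positions of the servers that respect the capacities are served for free. -/
theorem runCost_map_append {k : ℕ} [NeZero k] {s : Fin k → ℝ} (hinj : Function.Injective s)
    (c : Fin k → ℕ) (τ : List (Fin k)) (σ : List ℝ) :
    runCost s (greedySelect s) (c + fun j => τ.count j) (τ.map s ++ σ)
      = runCost s (greedySelect s) c σ := by
  induction τ with
  | nil =>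
    rfl
  | cons i τ ih =>
    have hc : (c + fun j => (i :: τ).count j) = (c + fun j => τ.count j) + Pi.single i 1 := by
      ext j
      rcases eq_or_ne j i with rfl | h
      · simp [add_assoc]
      · simp [h, List.count_cons_of_ne h.symm]
    have hsel : greedySelect s ((c + fun j => τ.count j) + Pi.single i 1) (s i) = i := by
      refine greedySelect_eq s (by simp) fun j _ hne => Or.inl ?_
      rw [sub_self, abs_zero, abs_pos, sub_ne_zero]
      exact fun h => hne (hinj h).symm
    rw [hc, List.map_cons, List.cons_append, runCost, hsel, add_tsub_cancel_right, ih,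
      sub_self, abs_zero, zero_add]

/-! ### The bad instance for greedy -/

section LowerBound

variable {m : ℕ} {s : Fin (m + 2) → ℝ} {x₀ d : ℝ}

/-- Servers `1, …, i` are full and the next request sits on server `i`. Each of the first `n`
requests moves one gap right and fills the server that the next request wants; the last finds only
server `0` free and pays the full span. -/
theorem runCost_chain (hd : 0 < d) (hs : ∀ j : Fin (m + 2), s j = x₀ + j * d) (n : ℕ) :
    ∀ i : ℕ, 1 ≤ i → i + n = m + 1 →
      runCost s (greedySelect s) (fun j => if j = 0 ∨ i < (j : ℕ) then 1 else 0)
        ((List.range' i (n + 1)).map fun t : ℕ => x₀ + t * d) = n * d + (m + 1) * d := by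
  induction n with
  | zero =>
    intro i _ hi
    have hsel : greedySelect s (fun j => if j = 0 ∨ i < (j : ℕ) then 1 else 0) (x₀ + i * d)
        = 0 := by
      refine greedySelect_eq s (by simp) fun j hj hne => ?_
      have := j.2
      have : i < (j : ℕ) := by
        by_contra h
        simp [hne, h] at hj
      omega
    simp only [zero_add, List.range'_one, List.map_cons, List.map_nil, runCost, hsel, hs]
    have hi' : (i : ℝ) = m + 1 := by exact_mod_cast hi
    rw [hi', show x₀ + ((m : ℝ) + 1) * d - (x₀ + ((0 : Fin (m + 2)) : ℕ) * d) = (m + 1) * d by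
      simp, abs_of_nonneg (by positivity)]
    simp
  | succ n ih =>
    intro i h1 hi
    have hlt : i + 1 < m + 2 := by omega
    have hi' : (1 : ℝ) ≤ i := by exact_mod_cast h1
    have hdist : |x₀ + i * d - s ⟨i + 1, hlt⟩| = d := by
      rw [hs, abs_sub_comm, show x₀ + ((⟨i + 1, hlt⟩ : Fin (m + 2)) : ℕ) * d - (x₀ + i * d) = d by
        push_cast
        ring, abs_of_pos hd]
    have hsel : greedySelect s (fun j => if j = 0 ∨ i < (j : ℕ) then 1 else 0) (x₀ + i * d)
        = ⟨i + 1, hlt⟩ := by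
      refine greedySelect_eq s (by simp) fun j hj hne => ?_
      rw [hdist, hs]
      by_cases hj0 : j = 0
      · subst hj0
        have h2 : |x₀ + i * d - (x₀ + ((0 : Fin (m + 2)) : ℕ) * d)| = i * d := by
          rw [show x₀ + i * d - (x₀ + ((0 : Fin (m + 2)) : ℕ) * d) = i * d by simp,
            abs_of_nonneg (by positivity)]
        rw [h2]
        -- Equality occurs at `i = 1`, where servers `0` and `2` are equally near and the larger
        -- index wins.
        rcases (show d ≤ i * d by nlinarith).lt_or_eq with h | h
        · exact Or.inl h
        · exact Or.inr ⟨h, by simp [Fin.lt_def]⟩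
      · have hij : i < (j : ℕ) := by
          by_contra h
          simp [hj0, h] at hj
        have hij' : i + 2 ≤ (j : ℕ) := by
          have : (j : ℕ) ≠ i + 1 := fun h => hne (Fin.ext h)
          omega
        have hij'' : (i : ℝ) + 2 ≤ ((j : ℕ) : ℝ) := by exact_mod_cast hij'
        left
        rw [abs_sub_comm]
        refine lt_of_lt_of_le ?_ (le_abs_self _)
        nlinarith
    have hstate : ((fun j : Fin (m + 2) => if j = 0 ∨ i < (j : ℕ) then 1 else 0) - Pi.single ⟨i + 1, hlt⟩ 1 :
        Fin (m + 2) → ℕ) = fun j : Fin (m + 2) => if j = 0 ∨ i + 1 < (j : ℕ) then 1 else 0 := by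
      ext j
      rcases eq_or_ne j ⟨i + 1, hlt⟩ with rfl | h
      · simp
      · have h' : (j : ℕ) ≠ i + 1 := fun h2 => h (Fin.ext h2)
        have h2 : i < (j : ℕ) ↔ i + 1 < (j : ℕ) := by omega
        simp [h, h2]
    rw [List.range'_succ, List.map_cons, runCost, hsel, hdist, hstate,
      ih (i + 1) (by omega) (by omega)]
    push_cast
    ring

/-- The midpoint request ties between servers `0` and `1` and takes `1`, which starts the chain: `d
/ 2 + m * d + (m + 1) * d`. -/
theorem runCost_half_cons (hd : 0 < d) (hs : ∀ j : Fin (m + 2), s j = x₀ + j * d) :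
    runCost s (greedySelect s) (fun _ => 1)
      ((x₀ + d / 2) :: (List.range' 1 (m + 1)).map fun t : ℕ => x₀ + t * d)
        = (4 * m + 3) * (d / 2) := by
  have hdist : |x₀ + d / 2 - s 1| = d / 2 := by
    rw [hs, abs_sub_comm, show x₀ + ((1 : Fin (m + 2)) : ℕ) * d - (x₀ + d / 2) = d / 2 by
      simp
      ring, abs_of_pos (by positivity)]
  have hsel : greedySelect s (fun _ => 1) (x₀ + d / 2) = 1 := by
    refine greedySelect_eq s (by simp) fun j _ hne => ?_
    rw [hdist, hs]
    by_cases hj0 : j = 0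
    · subst hj0
      refine Or.inr ⟨?_, by simp⟩
      rw [show x₀ + d / 2 - (x₀ + ((0 : Fin (m + 2)) : ℕ) * d) = d / 2 by simp,
        abs_of_pos (by positivity)]
    · have hj : 2 ≤ (j : ℕ) := by
        have h0 : (j : ℕ) ≠ 0 := fun h => hj0 (Fin.ext h)
        have h1 : (j : ℕ) ≠ 1 := fun h => hne (Fin.ext (by simpa using h))
        omega
      have hj' : (2 : ℝ) ≤ ((j : ℕ) : ℝ) := by exact_mod_cast hj
      left
      rw [abs_sub_comm]
      refine lt_of_lt_of_le ?_ (le_abs_self _)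
      nlinarith
  have hstate : ((fun _ => 1) - Pi.single 1 1 : Fin (m + 2) → ℕ)
      = fun j : Fin (m + 2) => if j = 0 ∨ 1 < (j : ℕ) then 1 else 0 := by
    ext j
    rcases eq_or_ne j 1 with rfl | h
    · simp
    · have h1 : (j : ℕ) ≠ 1 := fun h' => h (Fin.ext (by simpa using h'))
      have h2 : j = 0 ∨ 1 < (j : ℕ) := by
        by_cases h0 : (j : ℕ) = 0
        · exact Or.inl (Fin.ext h0)
        · right
          omega
      simp [h, h2]
  rw [runCost, hsel, hdist, hstate, runCost_chain hd hs m 1 le_rfl (by omega)]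
  ring

theorem le_of_greedy_isCompetitive {ℓ : ℕ} (hℓ : 1 ≤ ℓ) (hd : 0 < d)
    (hs : ∀ j : Fin (m + 2), s j = x₀ + j * d) {c : ℝ} (hc0 : 0 ≤ c)
    (hc : (greedy s ℓ).IsCompetitive s c) : 4 * m + 3 ≤ c := by
  obtain ⟨n, rfl⟩ : ∃ n, ℓ = n + 1 := ⟨ℓ - 1, by omega⟩
  have hinj : Function.Injective s := fun i j h => by
    rw [hs, hs, add_right_inj, mul_left_inj' hd.ne'] at h
    exact Fin.ext (by exact_mod_cast h)
  -- `ℓ - 1` free rounds over all servers reduce the instance to capacity one.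
  set τ : List (Fin (m + 2)) := (List.replicate n (List.finRange (m + 2))).flatten with hτ
  have hcount : ∀ j, τ.count j = n := fun j => by
    simp [hτ, List.count_flatten, List.count_eq_one_of_mem (List.nodup_finRange _)
      (List.mem_finRange j)]
  -- Offline, each request of the last round is served by its own server, so that only the midpoint
  -- request, served by `0`, costs anything.
  let q : Fin (m + 2) → ℝ := fun j => if j = 0 then x₀ + d / 2 else s j
  set ρ : List (ℝ × Fin (m + 2)) := τ.map (fun j => (s j, j))
    ++ (List.finRange (m + 2)).map (fun j => (q j, j)) with hρ
  have hq : (List.finRange (m + 2)).map q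
      = (x₀ + d / 2) :: (List.range' 1 (m + 1)).map fun t : ℕ => x₀ + t * d := by
    refine List.ext_getElem (by simp) fun i h1 h2 => ?_
    rcases i with _ | i
    · simp [q]
    · simp only [List.getElem_map, List.getElem_finRange, List.getElem_cons_succ,
        List.getElem_range', q]
      rw [if_neg (by simp [Fin.ext_iff]), hs]
      simp [add_comm]
  have hfst : ρ.map Prod.fst = τ.map s
      ++ ((x₀ + d / 2) :: (List.range' 1 (m + 1)).map fun t : ℕ => x₀ + t * d) := by
    rw [← hq, hρ, List.map_append, List.map_map, List.map_map]
    rfl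
  have hlen : (ρ.map Prod.fst).length ≤ (m + 2) * (n + 1) := by
    simp [hρ, hτ]
    ring_nf
    rfl
  have hfeas : ∀ j, ρ.countP (fun p => decide (p.2 = j)) ≤ n + 1 := fun j => by
    have h1 := hcount j
    have h2 := List.count_eq_one_of_mem (List.nodup_finRange _) (List.mem_finRange j)
    rw [List.count_eq_countP] at h1 h2
    rw [hρ, List.countP_append, List.countP_map, List.countP_map]
    exact (congrArg₂ (· + ·) h1 h2).le
  have hopt : opt s (n + 1) (ρ.map Prod.fst) ≤ d / 2 := by
    refine (opt_le s ρ hfeas).trans_eq ?_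
    rw [hρ, List.map_append, List.sum_append, List.map_map, List.map_map, List.finRange_succ,
      List.map_cons, List.sum_cons, List.map_map]
    have h1 : (τ.map ((fun p : ℝ × Fin (m + 2) => |p.1 - s p.2|) ∘ fun j => (s j, j))).sum
        = 0 := List.sum_eq_zero fun x hx => by
      obtain ⟨j, -, rfl⟩ := List.mem_map.1 hx
      simp
    have h2 : ((List.finRange (m + 1)).map (((fun p : ℝ × Fin (m + 2) => |p.1 - s p.2|) ∘
        fun j => (q j, j)) ∘ Fin.succ)).sum = 0 := List.sum_eq_zero fun x hx => by
      obtain ⟨j, -, rfl⟩ := List.mem_map.1 hx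
      simp [q]
    rw [h1, h2]
    simp [q, hs, abs_of_pos (half_pos hd)]
  have hcost : (greedy s (n + 1)).cost s (ρ.map Prod.fst) = (4 * m + 3) * (d / 2) := by
    rw [greedy_cost_eq s hlen, hfst, ← runCost_half_cons hd hs,
      ← runCost_map_append hinj (fun _ => 1) τ]
    congr 1
    ext j
    simp [hcount, add_comm]
  have h := hc (ρ.map Prod.fst) hlen
  rw [hcost] at h
  exact le_of_mul_le_mul_right (h.trans (mul_le_mul_of_nonneg_left hopt hc0)) (by positivity)

end LowerBound

end OFA

theorem mainTheorem2 (k ℓ : ℕ) (hk : 2 ≤ k) (hℓ : 1 ≤ ℓ) (s : Fin k → ℝ)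
    (hs : OFA.IsEquidistant s) :
    (OFA.greedy s ℓ).competitiveRatio s = ((4 * (k : ℝ) - 5 : ℝ) : EReal) := by
  have hk' : (2 : ℝ) ≤ k := by exact_mod_cast hk
  refine le_antisymm (sInf_le ⟨_, ⟨by linarith, OFA.greedy_isCompetitive hk hs⟩, rfl⟩)
    (le_sInf ?_)
  rintro _ ⟨c, ⟨hc1, hc⟩, rfl⟩
  refine EReal.coe_le_coe_iff.2 ?_
  obtain ⟨x₀, d, hd, hs'⟩ := hs.exists_eq (by omega)
  obtain ⟨m, rfl⟩ : ∃ m, k = m + 2 := ⟨k - 2, by omega⟩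
  have := OFA.le_of_greedy_isCompetitive hℓ hd hs' (by linarith) hc
  push_cast
  linarith
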